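/- Let $d\ge 1$, let $A,B\in\mathbb R^{d\times d}$, $\lambda_0\in\mathbb R^d$ with $\lambda_0\ge 0$, and let $\nu_1,\dots,\nu_d$ be probability measures on $\mathbb R$ with finite means; all inequalities between vectors are componentwise. Consider the linear self- and cross-exciting model with jump-size laws that do not depend on the intensity: on a probability space with a filtration $(\mathcal F_t)_{t\ge 0}$ there are events at times $T_1\le T_2\le\cdots$ in $[0,\infty]$ (finitely many in each bounded time interval, where $T_n=\infty$ means that there is no $n$-th event), the $n$-th event belongs to a component $X_n\in\{1,\dots,d\}$ and, if $X_n=k$, has a jump size $Y_n^k\ge 0$. Put $$N_k(t)=\sum_{n\ge1}1_{\{T_n\le t,\,X_n=k\}},\qquad U_k(t)=\sum_{n\ge1}Y^k_n1_{\{T_n\le t,\,X_n=k\}},\qquad U=(U_1,\dots,U_d)^\top .$$ The processes $N_k$, $U$ and $\lambda(t)=(\lambda_1(t),\dots,\lambda_d(t))^\top$ are adapted to $(\mathcal F_t)$, $\lambda$ is càdlàg with values in $[0,\infty)^d$, and * $\lambda_k$ is the intensity of $N_k$, i.e. $\mathbb E\left[\int_0^\infty f(s)\,dN_k(s)\right]=\mathbb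 E\left[\int_0^\infty f(s)\lambda_k(s)\,ds\right]$ for every non-negative predictable process $f$ and every $k$; * conditionally on $\mathcal F_{T_n-}$, on $T_n<\infty$ and on $X_n=k$, the jump size $Y_n^k$ has law $\nu_k$; * $d\lambda(t)=A(\lambda(t)-\lambda_0)\,dt+B\,dU(t)$ for $t\ge 0$, almost surely. Let $\mathbb E_\lambda$ denote the expectation when the process is started at the deterministic value $\lambda(0)=\lambda\ge\lambda_0$. Let $J$ be the diagonal matrix with diagonal entries $\int x\,\nu_k(dx)$, $k=1,\dots,d$, and $M=A+BJ$. Then $\lambda(t)$ is integrable for every $t\ge0$, and the following hold. 1. If $M$ is invertible, then for every $t\ge 0$ $$\mathbb E_\lambda[\lambda(t)]=M^{-1}A\lambda_0+e^{tM}\left(\lambda-M^{-1}A\lambda_0\right).$$ 2. If all eigenvalues of $M+M^\top$ are negative, then $M$ is invertible and $$\lim_{t\to\infty}\mathbb E_\lambda[\lambda(t)]=M^{-1}A\lambda_0 .$$ -/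

import Mathlib

open MeasureTheory ProbabilityTheory Filter Topology
open scoped NNReal ENNReal Matrix

/-- A `d`-dimensional point process with jump sizes on `Ω`. The `n`-th event (`n = 0, 1, 2, …`)
occurs at time `T n` (the value `∞` means that there is no `n`-th event), it belongs to the
component `X n`, and `Y k n` is the non-negative size of the jump at the `n`-th event if that event
belongs to component `k`. Only finitely many events occur in a bounded time interval. -/
structure MarkedPointProcess (Ω : Type*) [MeasurableSpace Ω] (d : ℕ) where
  /-- event times -/
  T : ℕ → Ω → ℝ≥0∞
  /-- components of the events -/
  X : ℕ → Ω → Fin d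
  /-- jump sizes -/
  Y : Fin d → ℕ → Ω → ℝ
  measurable_T : ∀ n, Measurable (T n)
  measurable_X : ∀ n, Measurable (X n)
  measurable_Y : ∀ k n, Measurable (Y k n)
  monotone_T : ∀ ω, Monotone fun n => T n ω
  finite_T : ∀ ω (t : ℝ≥0), {n | T n ω ≤ t}.Finite
  nonneg_Y : ∀ k n ω, 0 ≤ Y k n ω

namespace MarkedPointProcess

variable {Ω : Type*} [MeasurableSpace Ω] {d : ℕ} (S : MarkedPointProcess Ω d)

/-- The indices of the events of component `k` that occur up to time `t`. -/
def events (k : Fin d) (t : ℝ≥0) (ω : Ω) : Set ℕ :=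
  {n | S.T n ω ≤ t ∧ S.X n ω = k}

/-- The counting process `N_k(t)`, the number of events of component `k` up to time `t`. -/
noncomputable def count (k : Fin d) (t : ℝ≥0) (ω : Ω) : ℕ :=
  (S.events k t ω).ncard

/-- The vector `U(t)`: `U_k(t)` is the sum of the sizes of the jumps of component `k` up to
time `t` (a sum with finitely many nonzero terms). -/
noncomputable def jumpSum (t : ℝ≥0) (ω : Ω) : Fin d → ℝ :=
  fun k => ∑' n, (S.events k t ω).indicator (fun n => S.Y k n ω) n

/-- The integral `∫₀^∞ f(s) dN_k(s)` of a non-negative process `f`. -/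
noncomputable def countIntegral (k : Fin d) (f : ℝ≥0 × Ω → ℝ≥0∞) (ω : Ω) : ℝ≥0∞ :=
  ∑' n, {n | S.T n ω < ∞ ∧ S.X n ω = k}.indicator (fun n => f ((S.T n ω).toNNReal, ω)) n

end MarkedPointProcess

/-- The σ-algebra `𝓕_{τ-}` of the events strictly prior to the random time `τ`, generated by `𝓕 0`
and the sets `A ∩ {t < τ}` with `A ∈ 𝓕 t`. -/
@[reducible]
def strictlyPrior {Ω : Type*} [mΩ : MeasurableSpace Ω] (𝓕 : Filtration ℝ≥0 mΩ) (τ : Ω → ℝ≥0∞) :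
    MeasurableSpace Ω :=
  𝓕 0 ⊔ MeasurableSpace.generateFrom
    {G | ∃ (t : ℝ≥0) (A : Set Ω), MeasurableSet[𝓕 t] A ∧ G = A ∩ {ω | (t : ℝ≥0∞) < τ ω}}

/-- A path on `[0, ∞)` that is right-continuous and has left limits. -/
def IsCadlagPath {E : Type*} [TopologicalSpace E] (x : ℝ≥0 → E) : Prop :=
  ∀ t, ContinuousWithinAt x (Set.Ici t) t ∧ ∃ l, Tendsto x (𝓝[<] t) (𝓝 l)

/-- `S` is a multivariate SDE-driven self-exciting jump process with intensity `lam`, drift `μ`,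
matrix `B` and jump-size distributions `ν k (lam(t-), ·)`, started from `lam(0) = x`, with respect
to the filtration `𝓕`. -/
structure IsSDEDrivenSelfExciting {Ω : Type*} [mΩ : MeasurableSpace Ω] {d : ℕ}
    (P : Measure Ω) (𝓕 : Filtration ℝ≥0 mΩ)
    (μ : ℝ → (Fin d → ℝ) → (Fin d → ℝ)) (B : Matrix (Fin d) (Fin d) ℝ)
    (ν : Fin d → Kernel (Fin d → ℝ) ℝ) (x : Fin d → ℝ)
    (S : MarkedPointProcess Ω d) (lam : ℝ≥0 → Ω → (Fin d → ℝ)) : Prop where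
  adapted_count : ∀ k, Adapted 𝓕 (S.count k)
  adapted_jumpSum : Adapted 𝓕 S.jumpSum
  adapted_lam : Adapted 𝓕 lam
  cadlag_lam : ∀ ω, IsCadlagPath fun t => lam t ω
  nonneg_lam : ∀ t ω, 0 ≤ lam t ω
  /-- `lam k` is the `(P, 𝓕)`-intensity of the counting process of component `k`:
  `E[∫₀^∞ f dN_k] = E[∫₀^∞ f(s) lam_k(s) ds]` for all non-negative predictable `f`. -/
  intensity : ∀ (k : Fin d) (f : ℝ≥0 × Ω → ℝ≥0∞), Measurable[𝓕.predictable] f →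
    ∫⁻ ω, S.countIntegral k f ω ∂P =
      ∫⁻ ω, (∫⁻ s in Set.Ici (0 : ℝ),
        f (s.toNNReal, ω) * ENNReal.ofReal (lam s.toNNReal ω k) ∂(volume : Measure ℝ)) ∂P
  /-- Given the history strictly before the time `T n` of the `n`-th event, and given that this
  event belongs to component `k`, the jump size is distributed as `ν k (lam(T n -), ·)`. -/
  jump_law : ∀ (n : ℕ) (k : Fin d) (G : Set Ω), MeasurableSet[strictlyPrior 𝓕 (S.T n)] G →
    ∀ C : Set ℝ, MeasurableSet C →
      P (G ∩ {ω | S.T n ω < ∞ ∧ S.X n ω = k ∧ S.Y k n ω ∈ C}) =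
        ∫⁻ ω in G ∩ {ω | S.T n ω < ∞ ∧ S.X n ω = k},
          ν k (Function.leftLim (fun t => lam t ω) (S.T n ω).toNNReal) C ∂P
  initial : ∀ᵐ ω ∂P, lam 0 ω = x
  drift_integrable : ∀ᵐ ω ∂P, ∀ t : ℝ≥0,
    IntervalIntegrable (fun s : ℝ => μ s (lam s.toNNReal ω)) volume 0 t
  /-- `d lam(t) = μ(t, lam(t)) dt + B dU(t)`, in integrated form. -/
  sde : ∀ᵐ ω ∂P, ∀ t : ℝ≥0,
    lam t ω = lam 0 ω + (∫ s in (0 : ℝ)..t, μ s (lam s.toNNReal ω)) + B *ᵥ S.jumpSum t ω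

/-- The drift `μ(t, y) = A (y - lam0)` of the linear model. -/
def linearDrift {d : ℕ} (A : Matrix (Fin d) (Fin d) ℝ) (lam0 : Fin d → ℝ) :
    ℝ → (Fin d → ℝ) → (Fin d → ℝ) :=
  fun _ y => A *ᵥ (y - lam0)

/-- The matrix `M = A + B J`, where `J` is diagonal with the mean jump sizes `∫ x ν_k(dx)` on the
diagonal. -/
noncomputable def meanMatrix {d : ℕ} (A B : Matrix (Fin d) (Fin d) ℝ) (ν : Fin d → Measure ℝ) :
    Matrix (Fin d) (Fin d) ℝ :=
  A + B * Matrix.diagonal fun k => ∫ x, x ∂(ν k)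

/-! Write `m_k` for the mean of `ν k` and `J` for the diagonal matrix of the `m_k`. Jump sizes are
independent of the strict past and counts have intensity `lam`, so `E U_k(t) = m_k E N_k(t) = m_k
∫₀ᵗ E lam_k(s) ds`. Taking expectations in the SDE then gives `E lam(t) = x + ∫₀ᵗ (M E lam(s) - A
lam0) ds`. Centred at the equilibrium `M⁻¹ A lam0`, this is the homogeneous Volterra equation of
`M`, whose only solution is `exp(tM)` applied to the initial value
(`eq_exp_smul_mulVec_of_integral_eq`).

The real work is integrability, since the equation for the mean presupposes it. The intensity is cut
off at the `n`-th event (`normBefore`), so that at most `n` jumps of finite mean contribute.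
Grönwall along each path makes the cut-off moments finite (`lintegral_normBefore_ne_top`). Grönwall
for the expectations then bounds them by constants free of `n` (`exists_lintegral_enorm_lam_le`),
and monotone convergence removes the cut-off.

For the limit, negativity of `M + Mᵀ` gives `2 v·Mv ≤ -c v·v` with `c > 0`. This forces `M` to be
injective and makes `exp(tM)v` decay exponentially. -/

/-! ### Grönwall's inequality -/

theorem lintegral_Ici_exp_neg_mul {b : ℝ} (hb : 0 < b) (s : ℝ) :
    ∫⁻ t in Set.Ici s, ENNReal.ofReal (Real.exp (-(b * t))) =
      ENNReal.ofReal (Real.exp (-(b * s)) / b) := by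
  rw [setLIntegral_congr Ioi_ae_eq_Ici.symm]
  have hb' : -b < 0 := by linarith
  have h1 := integrableOn_exp_mul_Ioi hb' s
  have h2 := integral_exp_mul_Ioi hb' s
  simp only [neg_mul] at h1 h2
  rw [← ofReal_integral_eq_lintegral_ofReal h1 (ae_of_all _ fun _ => (Real.exp_pos _).le), h2,
    neg_div_neg_eq]

/-- Integral form of Grönwall's inequality, for extended non-negative functions. -/
theorem exists_lintegral_le_of_le_add_lintegral (K : ℝ≥0) (T : ℝ) :
    ∃ C : ℝ≥0, ∀ h : ℝ → ℝ≥0∞, Measurable h → ∀ a : ℝ≥0∞,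
      (∀ t ∈ Set.Ioc 0 T, h t ≤ a + K * ∫⁻ s in Set.Ioc 0 t, h s) →
      ∫⁻ s in Set.Ioc 0 T, h s ≠ ∞ → ∫⁻ s in Set.Ioc 0 T, h s ≤ C * a := by
  -- With weight `exp(-bt)` the kernel `K` has tail integral at most `K/b ≤ 1/2` of the weight, so
  -- the iterated integral is absorbed by the left side. The `+ 1` keeps `b` positive when `K = 0`.
  set b : ℝ := 2 * (K + 1) with hb
  have hb0 : 0 < b := by positivity
  set w : ℝ → ℝ≥0∞ := fun t => ENNReal.ofReal (Real.exp (-(b * t))) with hw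
  have hwm : Measurable w := by fun_prop
  have hw1 : ∀ t, 0 ≤ t → w t ≤ 1 := fun t ht => by
    rw [hw, ← ENNReal.ofReal_one]
    apply ENNReal.ofReal_le_ofReal
    rw [Real.exp_le_one_iff]
    have := mul_nonneg hb0.le ht
    linarith
  have htail : ∀ s, K * ∫⁻ t in Set.Ici s, w t ≤ 2⁻¹ * w s := fun s => by
    rw [lintegral_Ici_exp_neg_mul hb0, ← ENNReal.ofReal_coe_nnreal,
      ← ENNReal.ofReal_mul (by positivity), hw,
      show (2⁻¹ : ℝ≥0∞) = ENNReal.ofReal 2⁻¹ by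
        rw [ENNReal.ofReal_inv_of_pos two_pos]; simp,
      ← ENNReal.ofReal_mul (by positivity)]
    apply ENNReal.ofReal_le_ofReal
    have h1 : (K : ℝ) / b ≤ 2⁻¹ := by
      rw [div_le_iff₀ hb0, hb]; linarith
    calc (K : ℝ) * (Real.exp (-(b * s)) / b) = K / b * Real.exp (-(b * s)) := by ring
      _ ≤ _ := by gcongr
  refine ⟨(Real.exp (b * T)).toNNReal * (2 * T.toNNReal), fun h hm a hle hfin => ?_⟩
  set S : ℝ≥0∞ := ∫⁻ t in Set.Ioc 0 T, w t * h t with hS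
  -- Finiteness is what later allows `2⁻¹ * S` to be cancelled in `ℝ≥0∞`.
  have hSfin : S ≠ ∞ := by
    refine ne_top_of_le_ne_top hfin (setLIntegral_mono hm fun t ht => ?_)
    calc w t * h t ≤ 1 * h t := by gcongr; exact hw1 t ht.1.le
      _ = h t := one_mul _
  have hdouble : ∫⁻ t in Set.Ioc 0 T, w t * (K * ∫⁻ s in Set.Ioc 0 t, h s) ≤ 2⁻¹ * S := by
    have hFm : Measurable fun p : ℝ × ℝ =>
        {q : ℝ × ℝ | q.2 ≤ q.1}.indicator (fun q => w q.1 * (K * h q.2)) p := by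
      refine Measurable.indicator (by fun_prop) (measurableSet_le measurable_snd measurable_fst)
    calc ∫⁻ t in Set.Ioc 0 T, w t * (K * ∫⁻ s in Set.Ioc 0 t, h s)
        ≤ ∫⁻ t in Set.Ioc 0 T, ∫⁻ s in Set.Ioc 0 T,
          {q : ℝ × ℝ | q.2 ≤ q.1}.indicator (fun q => w q.1 * (K * h q.2)) (t, s) := by
          refine setLIntegral_mono' measurableSet_Ioc fun t ht => ?_
          rw [← lintegral_const_mul _ hm, ← lintegral_const_mul _ (by fun_prop),
            ← lintegral_indicator measurableSet_Ioc, ← lintegral_indicator measurableSet_Ioc]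
          refine lintegral_mono fun s => ?_
          by_cases hs : s ∈ Set.Ioc 0 t
          · have hs' : s ∈ Set.Ioc 0 T := ⟨hs.1, hs.2.trans ht.2⟩
            simp [hs, hs', hs.2]
          · simp [hs]
      _ = ∫⁻ s in Set.Ioc 0 T, ∫⁻ t in Set.Ioc 0 T,
          {q : ℝ × ℝ | q.2 ≤ q.1}.indicator (fun q => w q.1 * (K * h q.2)) (t, s) :=
          lintegral_lintegral_swap hFm.aemeasurable
      _ ≤ ∫⁻ s in Set.Ioc 0 T, 2⁻¹ * (w s * h s) := by
          refine setLIntegral_mono' measurableSet_Ioc fun s hs => ?_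
          calc ∫⁻ t in Set.Ioc 0 T,
                {q : ℝ × ℝ | q.2 ≤ q.1}.indicator (fun q => w q.1 * (K * h q.2)) (t, s)
              ≤ ∫⁻ t in Set.Ici s, w t * (K * h s) := by
                rw [← lintegral_indicator measurableSet_Ici]
                refine (setLIntegral_le_lintegral _ _).trans (lintegral_mono fun t => ?_)
                by_cases hst : s ≤ t <;> simp [hst]
            _ = K * (∫⁻ t in Set.Ici s, w t) * h s := by
                rw [lintegral_mul_const _ hwm]; ring
            _ ≤ 2⁻¹ * w s * h s := mul_le_mul_left (htail s) _
            _ = _ := by ring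
      _ = 2⁻¹ * S := lintegral_const_mul _ (by fun_prop)
  have hS2 : S ≤ a * ENNReal.ofReal T + 2⁻¹ * S := by
    calc S ≤ ∫⁻ t in Set.Ioc 0 T, (a + w t * (K * ∫⁻ s in Set.Ioc 0 t, h s)) := by
          refine setLIntegral_mono' measurableSet_Ioc fun t ht => ?_
          calc w t * h t ≤ w t * (a + K * ∫⁻ s in Set.Ioc 0 t, h s) := by
                gcongr; exact hle t ht
            _ ≤ _ := by
                rw [mul_add]
                gcongr
                calc w t * a ≤ 1 * a := by gcongr; exact hw1 t ht.1.le
                  _ = a := one_mul a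
      _ = a * ENNReal.ofReal T +
          ∫⁻ t in Set.Ioc 0 T, w t * (K * ∫⁻ s in Set.Ioc 0 t, h s) := by
          rw [lintegral_add_left measurable_const]; simp
      _ ≤ _ := by gcongr
  have hS3 : S ≤ 2 * (a * ENNReal.ofReal T) := by
    have h2 : S = 2⁻¹ * S + 2⁻¹ * S := by
      rw [← add_mul, ENNReal.inv_two_add_inv_two, one_mul]
    have h3 : 2⁻¹ * S ≤ a * ENNReal.ofReal T := by
      have hf : 2⁻¹ * S ≠ ∞ := ENNReal.mul_ne_top (by simp) hSfin
      exact ENNReal.le_of_add_le_add_right hf (h2.symm.le.trans hS2)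
    calc S = 2⁻¹ * S + 2⁻¹ * S := h2
      _ ≤ a * ENNReal.ofReal T + a * ENNReal.ofReal T := by gcongr
      _ = _ := by ring
  calc ∫⁻ s in Set.Ioc 0 T, h s
      ≤ ∫⁻ s in Set.Ioc 0 T, ENNReal.ofReal (Real.exp (b * T)) * (w s * h s) := by
        refine setLIntegral_mono' measurableSet_Ioc fun s hs => ?_
        rw [← mul_assoc, hw, ← ENNReal.ofReal_mul (by positivity), ← Real.exp_add]
        calc h s = ENNReal.ofReal 1 * h s := by simp
          _ ≤ _ := by
            gcongr
            rw [Real.one_le_exp_iff]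
            have := mul_le_mul_of_nonneg_left hs.2 hb0.le
            linarith
    _ = ENNReal.ofReal (Real.exp (b * T)) * S := lintegral_const_mul _ (by fun_prop)
    _ ≤ ENNReal.ofReal (Real.exp (b * T)) * (2 * (a * ENNReal.ofReal T)) := by gcongr
    _ = _ := by
        rw [ENNReal.coe_mul, ENNReal.coe_mul, ENNReal.ofReal, ENNReal.ofReal]
        push_cast
        ring

/-! ### Matrix exponentials and the linear Volterra equation -/

theorem Matrix.exists_enorm_mulVec_le {d : ℕ} (M : Matrix (Fin d) (Fin d) ℝ) :
    ∃ a : ℝ≥0, ∀ v : Fin d → ℝ, ‖M *ᵥ v‖ₑ ≤ a * ‖v‖ₑ := by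
  refine ⟨‖(Matrix.mulVecLin M).toContinuousLinearMap‖₊, fun v => ?_⟩
  have := (Matrix.mulVecLin M).toContinuousLinearMap.le_opNNNorm v
  simp only [LinearMap.coe_toContinuousLinearMap', Matrix.mulVecLin_apply] at this
  simp only [enorm_eq_nnnorm]
  exact_mod_cast this

theorem Matrix.hasDerivAt_exp_smul_mulVec {d : ℕ} (M : Matrix (Fin d) (Fin d) ℝ)
    (v : Fin d → ℝ) (t : ℝ) :
    HasDerivAt (fun t : ℝ => NormedSpace.exp (t • M) *ᵥ v)
      (M *ᵥ (NormedSpace.exp (t • M) *ᵥ v)) t := by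
  let _ : NormedRing (Matrix (Fin d) (Fin d) ℝ) := Matrix.linftyOpNormedRing
  let _ : NormedAlgebra ℝ (Matrix (Fin d) (Fin d) ℝ) := Matrix.linftyOpNormedAlgebra
  have h1 := hasDerivAt_exp_smul_const' (𝕂 := ℝ) M t
  have h2 := (((Matrix.mulVecBilin ℝ ℝ).flip v).toContinuousLinearMap.hasFDerivAt
    (x := NormedSpace.exp (t • M))).comp_hasDerivAt t h1
  simp only [Function.comp_def, LinearMap.coe_toContinuousLinearMap'] at h2
  rw [Matrix.mulVec_mulVec]
  exact h2

/-- The linear Volterra equation `z(t) = z₀ + ∫₀ᵗ M z(s) ds` has only the solution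
`z(t) = exp(t M) z₀`. -/
theorem eq_exp_smul_mulVec_of_integral_eq {d : ℕ} (M : Matrix (Fin d) (Fin d) ℝ)
    {z : ℝ → Fin d → ℝ} {z₀ : Fin d → ℝ} (hz : Measurable z)
    (hint : ∀ T, IntegrableOn z (Set.Ioc 0 T))
    (heq : ∀ t, 0 ≤ t → z t = z₀ + ∫ s in (0 : ℝ)..t, M *ᵥ z s) {t : ℝ} (ht : 0 ≤ t) :
    z t = NormedSpace.exp (t • M) *ᵥ z₀ := by
  set e : ℝ → Fin d → ℝ := fun t => NormedSpace.exp (t • M) *ᵥ z₀ with he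
  have hed : ∀ t, HasDerivAt e (M *ᵥ e t) t := Matrix.hasDerivAt_exp_smul_mulVec M z₀
  have hec : Continuous e := continuous_iff_continuousAt.2 fun t => (hed t).continuousAt
  have hL : Continuous fun v : Fin d → ℝ => M *ᵥ v := by fun_prop
  have hMi : ∀ {f : ℝ → Fin d → ℝ} {T : ℝ}, IntegrableOn f (Set.Ioc 0 T) →
      IntegrableOn (fun s => M *ᵥ f s) (Set.Ioc 0 T) := fun hf =>
    (Matrix.mulVecLin M).toContinuousLinearMap.integrable_comp hf
  have heq' : ∀ t, 0 ≤ t → e t = z₀ + ∫ s in (0 : ℝ)..t, M *ᵥ e s := fun t _ => by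
    rw [intervalIntegral.integral_eq_sub_of_hasDerivAt (fun s _ => hed s)
      ((hL.comp hec).intervalIntegrable _ _)]
    simp [he]
  have hdi : ∀ T, IntegrableOn (fun s => z s - e s) (Set.Ioc 0 T) := fun T =>
    (hint T).sub (hec.integrableOn_Ioc)
  have hdiff : ∀ t, 0 ≤ t → z t - e t = ∫ s in (0 : ℝ)..t, M *ᵥ (z s - e s) := fun t ht => by
    simp only [Matrix.mulVec_sub]
    rw [intervalIntegral.integral_sub, heq t ht, heq' t ht, add_sub_add_left_eq_sub]
    · exact (intervalIntegrable_iff_integrableOn_Ioc_of_le ht).2 (hMi (hint t))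
    · exact (hL.comp hec).intervalIntegrable _ _
  obtain ⟨K, hK⟩ := M.exists_enorm_mulVec_le
  have hbound : ∀ t, 0 ≤ t → ‖z t - e t‖ₑ ≤ K * ∫⁻ s in Set.Ioc 0 t, ‖z s - e s‖ₑ :=
    fun t ht => by
    rw [hdiff t ht, intervalIntegral.integral_of_le ht, ← lintegral_const_mul _ (by fun_prop)]
    exact (enorm_integral_le_lintegral_enorm _).trans (lintegral_mono fun s => hK _)
  -- Grönwall with `a = 0` kills only the integral of the difference; `hbound` turns this into
  -- vanishing at the point `t` itself.
  obtain ⟨C, hC⟩ := exists_lintegral_le_of_le_add_lintegral K t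
  have h0 := hC (fun s => ‖z s - e s‖ₑ) (by fun_prop) 0
    (fun s hs => by simpa using hbound s hs.1.le) (hdi t).2.ne
  have h1 := (hbound t ht).trans (mul_le_mul_right h0 _)
  simpa [sub_eq_zero] using h1

/-! ### Stability from a negative symmetric part -/

/-- Since `v·Mᵀv = v·Mv`, the form `2 v·Mv` is that of the symmetric matrix `M + Mᵀ`, negative
definite by the spectral theorem. Its maximum on the compact unit sphere is `-c`, and homogeneity
extends the bound to all `v`. -/
theorem Matrix.exists_pos_dotProduct_mulVec_le {d : ℕ} {M : Matrix (Fin d) (Fin d) ℝ}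
    (hM : ∀ γ : ℝ, Module.End.HasEigenvalue (Matrix.toLin' (M + Mᵀ)) γ → γ < 0) :
    ∃ c > 0, ∀ v : Fin d → ℝ, 2 * (v ⬝ᵥ (M *ᵥ v)) ≤ -c * (v ⬝ᵥ v) := by
  have hH : (-(M + Mᵀ)).IsHermitian := by
    rw [Matrix.IsHermitian, Matrix.conjTranspose_eq_transpose_of_trivial]
    simp [add_comm]
  have hpos : (-(M + Mᵀ)).PosDef := by
    rw [hH.posDef_iff_eigenvalues_pos]
    intro i
    have h1 := hH.mulVec_eigenvectorBasis i
    suffices h : -(hH.eigenvalues i) < 0 by linarith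
    apply hM
    refine Module.End.hasEigenvalue_of_hasEigenvector
      (x := (hH.eigenvectorBasis i : Fin d → ℝ)) ⟨?_, ?_⟩
    · rw [Module.End.mem_eigenspace_iff, Matrix.toLin'_apply]
      rw [Matrix.neg_mulVec, neg_eq_iff_eq_neg] at h1
      rw [h1, neg_smul]
    · intro h0
      exact hH.eigenvectorBasis.orthonormal.ne_zero i (by ext j; exact congrFun h0 j)
  have hquad : ∀ v : Fin d → ℝ, v ≠ 0 → 2 * (v ⬝ᵥ (M *ᵥ v)) < 0 := fun v hv => by
    have h1 := hpos.dotProduct_mulVec_pos hv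
    have h2 : v ⬝ᵥ (Mᵀ *ᵥ v) = v ⬝ᵥ (M *ᵥ v) := by
      rw [Matrix.mulVec_transpose, dotProduct_comm, Matrix.dotProduct_mulVec]
    simp only [star_trivial, Matrix.neg_mulVec, Matrix.add_mulVec, dotProduct_neg, dotProduct_add,
      h2] at h1
    linarith
  have hcompact : IsCompact {v : Fin d → ℝ | v ⬝ᵥ v = 1} := by
    refine Metric.isCompact_of_isClosed_isBounded
      (isClosed_eq (by unfold dotProduct; fun_prop) continuous_const) ?_
    refine (Metric.isBounded_closedBall (x := (0 : Fin d → ℝ)) (r := 1)).subset fun v hv => ?_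
    rw [mem_closedBall_zero_iff, pi_norm_le_iff_of_nonneg zero_le_one]
    intro i
    rw [Real.norm_eq_abs, ← sq_le_one_iff_abs_le_one, ← (hv : v ⬝ᵥ v = 1), sq]
    exact Finset.single_le_sum (f := fun i => v i * v i) (fun j _ => mul_self_nonneg _)
      (Finset.mem_univ i)
  obtain ⟨c, hc, hcle⟩ : ∃ c > 0, ∀ v : Fin d → ℝ, v ⬝ᵥ v = 1 → 2 * (v ⬝ᵥ (M *ᵥ v)) ≤ -c := by
    -- The sphere is empty exactly when `d = 0`, and any `c` serves.
    rcases Set.eq_empty_or_nonempty {v : Fin d → ℝ | v ⬝ᵥ v = 1} with he | hne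
    · exact ⟨1, one_pos, fun v hv => absurd hv (Set.eq_empty_iff_forall_notMem.1 he v)⟩
    · obtain ⟨u, hu, hmax⟩ := hcompact.exists_isMaxOn hne
        (f := fun v => 2 * (v ⬝ᵥ (M *ᵥ v)))
        (by unfold dotProduct Matrix.mulVec dotProduct; fun_prop)
      refine ⟨-(2 * (u ⬝ᵥ (M *ᵥ u))), ?_, fun v hv => ?_⟩
      · have hu0 : u ≠ 0 := by rintro rfl; simp at hu
        linarith [hquad u hu0]
      · simpa using hmax hv
  refine ⟨c, hc, fun v => ?_⟩
  by_cases hv : v = 0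
  · simp [hv]
  have hvv : 0 < v ⬝ᵥ v := by
    have := Matrix.dotProduct_star_self_pos_iff.2 hv
    simpa using this
  set r := Real.sqrt (v ⬝ᵥ v) with hr
  have hr0 : 0 < r := Real.sqrt_pos.2 hvv
  have hr2 : r * r = v ⬝ᵥ v := Real.mul_self_sqrt hvv.le
  have h1 := hcle (r⁻¹ • v) (by
    rw [smul_dotProduct, dotProduct_smul, ← hr2, smul_eq_mul, smul_eq_mul]
    field_simp)
  rw [Matrix.mulVec_smul, smul_dotProduct, dotProduct_smul, smul_eq_mul, smul_eq_mul] at h1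
  have h2 : 2 * (v ⬝ᵥ (M *ᵥ v)) = r * r * (2 * (r⁻¹ * (r⁻¹ * (v ⬝ᵥ (M *ᵥ v))))) := by
    field_simp
  rw [h2, ← hr2]
  nlinarith [mul_pos hr0 hr0]

theorem Matrix.isUnit_of_dotProduct_mulVec_le {d : ℕ} {M : Matrix (Fin d) (Fin d) ℝ} {c : ℝ}
    (hc : 0 < c) (hM : ∀ v : Fin d → ℝ, 2 * (v ⬝ᵥ (M *ᵥ v)) ≤ -c * (v ⬝ᵥ v)) : IsUnit M := by
  rw [← Matrix.mulVec_injective_iff_isUnit]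
  refine (injective_iff_map_eq_zero (Matrix.mulVecLin M)).2 fun v hv => ?_
  have h1 := hM v
  rw [show M *ᵥ v = 0 from hv, dotProduct_zero] at h1
  by_contra hne
  have := Matrix.dotProduct_star_self_pos_iff.2 hne
  rw [star_trivial] at this
  nlinarith

/-- Along `e(t) = exp(tM)v` the function `exp(ct) e(t)·e(t)` has derivative `exp(ct)(c e·e + 2 e·Me)
≤ 0`, whence `e(t)·e(t) ≤ exp(-ct) v·v`. -/
theorem Matrix.tendsto_exp_smul_mulVec_zero {d : ℕ} {M : Matrix (Fin d) (Fin d) ℝ} {c : ℝ}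
    (hc : 0 < c) (hM : ∀ v : Fin d → ℝ, 2 * (v ⬝ᵥ (M *ᵥ v)) ≤ -c * (v ⬝ᵥ v)) (v : Fin d → ℝ) :
    Tendsto (fun t : ℝ => NormedSpace.exp (t • M) *ᵥ v) atTop (𝓝 0) := by
  set e : ℝ → Fin d → ℝ := fun t => NormedSpace.exp (t • M) *ᵥ v with he
  have hed : ∀ t, HasDerivAt e (M *ᵥ e t) t := Matrix.hasDerivAt_exp_smul_mulVec M v
  have hq : ∀ t, HasDerivAt (fun t => e t ⬝ᵥ e t) (2 * (e t ⬝ᵥ (M *ᵥ e t))) t := fun t => by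
    have h1 : ∀ i, HasDerivAt (fun t => e t i * e t i) (2 * (e t i * (M *ᵥ e t) i)) t := fun i => by
      have h2 := hasDerivAt_pi.1 (hed t) i
      exact (h2.fun_mul h2).congr_deriv (by ring)
    have h3 := HasDerivAt.fun_sum (u := Finset.univ) fun i _ => h1 i
    simpa [dotProduct, Finset.mul_sum] using h3
  have hφ : ∀ t, HasDerivAt (fun t => Real.exp (c * t) * (e t ⬝ᵥ e t))
      (Real.exp (c * t) * c * (e t ⬝ᵥ e t) +
        Real.exp (c * t) * (2 * (e t ⬝ᵥ (M *ᵥ e t)))) t := fun t => by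
    have h1 : HasDerivAt (fun t => Real.exp (c * t)) (Real.exp (c * t) * c) t := by
      simpa using ((hasDerivAt_id t).const_mul c).exp
    exact h1.mul (hq t)
  have hanti : Antitone fun t => Real.exp (c * t) * (e t ⬝ᵥ e t) :=
    antitone_of_deriv_nonpos (fun t => (hφ t).differentiableAt) fun t => by
      rw [(hφ t).deriv]
      nlinarith [hM (e t), Real.exp_pos (c * t)]
  have hle : ∀ t, 0 ≤ t → e t ⬝ᵥ e t ≤ Real.exp (-(c * t)) * (e 0 ⬝ᵥ e 0) := fun t ht => by
    have h1 := hanti ht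
    simp only [mul_zero, Real.exp_zero, one_mul] at h1
    rw [Real.exp_neg, inv_mul_eq_div, le_div_iff₀ (Real.exp_pos _)]
    linarith
  have hlim : Tendsto (fun t => Real.exp (-(c * t)) * (e 0 ⬝ᵥ e 0)) atTop (𝓝 0) := by
    have h1 : Tendsto (fun t => Real.exp (-(c * t))) atTop (𝓝 0) :=
      Real.tendsto_exp_neg_atTop_nhds_zero.comp (tendsto_id.const_mul_atTop hc)
    simpa using h1.mul_const (e 0 ⬝ᵥ e 0)
  have hsq : Tendsto (fun t => e t ⬝ᵥ e t) atTop (𝓝 0) :=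
    squeeze_zero' (.of_forall fun t => by
      exact Finset.sum_nonneg fun i _ => mul_self_nonneg (e t i)) ((eventually_ge_atTop 0).mono hle) hlim
  rw [tendsto_pi_nhds]
  intro i
  have h1 : Tendsto (fun t => Real.sqrt (e t ⬝ᵥ e t)) atTop (𝓝 0) := by
    simpa [Function.comp_def] using (Real.continuous_sqrt.tendsto 0).comp hsq
  refine squeeze_zero_norm (fun t => ?_) h1
  rw [Real.norm_eq_abs]
  apply Real.abs_le_sqrt
  rw [sq]
  exact Finset.single_le_sum (f := fun i => e t i * e t i) (fun j _ => mul_self_nonneg _)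
      (Finset.mem_univ i)

/-! ### Càdlàg paths: local boundedness and joint measurability -/

/-- One-sided limits bound the path near each point, and compactness of `[0, T]` does the rest. This
supplies the finiteness that pathwise Grönwall requires. -/
theorem IsCadlagPath.exists_nnnorm_le {E : Type*} [SeminormedAddCommGroup E] {x : ℝ≥0 → E}
    (hx : IsCadlagPath x) (T : ℝ≥0) : ∃ C : ℝ≥0, ∀ t ≤ T, ‖x t‖₊ ≤ C := by
  have hloc : ∀ {F : Filter ℝ≥0} {l : E}, Tendsto x F (𝓝 l) → ∃ C, ∀ᶠ t in F, ‖x t‖₊ ≤ C :=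
    fun {_ l} hl => ⟨‖l‖₊ + 1,
      (hl.nnnorm.eventually_lt_const (lt_add_one _)).mono fun _ => le_of_lt⟩
  suffices h : ∃ C : ℝ≥0, ∀ t ∈ Set.Icc 0 T, ‖x t‖₊ ≤ C by
    obtain ⟨C, hC⟩ := h
    exact ⟨C, fun t ht => hC t ⟨zero_le, ht⟩⟩
  refine isCompact_Icc.induction_on (p := fun s => ∃ C : ℝ≥0, ∀ t ∈ s, ‖x t‖₊ ≤ C) ⟨0, by simp⟩
    (fun s t hst ⟨C, hC⟩ => ⟨C, fun u hu => hC u (hst hu)⟩)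
    (fun s t ⟨C, hC⟩ ⟨D, hD⟩ => ⟨max C D, fun u hu => hu.elim
      (fun hu => (hC u hu).trans (le_max_left _ _))
      (fun hu => (hD u hu).trans (le_max_right _ _))⟩) fun t _ => ?_
  obtain ⟨C, hC⟩ := hloc (hx t).1
  obtain ⟨l, hl⟩ := (hx t).2
  obtain ⟨D, hD⟩ := hloc hl
  refine ⟨_, mem_nhdsWithin_of_mem_nhds ?_, max C D, fun u hu => hu⟩
  change ∀ᶠ u in 𝓝 t, ‖x u‖₊ ≤ max C D
  rw [← nhdsLT_sup_nhdsGE t, eventually_sup]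
  exact ⟨hD.mono fun u hu => hu.trans (le_max_right _ _),
    hC.mono fun u hu => hu.trans (le_max_left _ _)⟩

theorem measurable_uncurry_of_isCadlagPath {Ω E : Type*} [MeasurableSpace Ω]
    [TopologicalSpace E] [TopologicalSpace.PseudoMetrizableSpace E] [MeasurableSpace E]
    [BorelSpace E]
    {X : ℝ≥0 → Ω → E} (hX : ∀ t, Measurable (X t)) (hc : ∀ ω, IsCadlagPath fun t => X t ω) :
    Measurable fun p : ℝ≥0 × Ω => X p.1 p.2 := by
  -- `g n t` is the first point of the grid of mesh `1/(n+1)` strictly to the right of `t`. It takes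
  -- countably many values, and right-continuity gives convergence.
  set g : ℕ → ℝ≥0 → ℝ≥0 := fun n t => ((⌊t * (n + 1)⌋₊ : ℝ≥0) + 1) / (n + 1) with hg
  have hlt : ∀ n t, t ≤ g n t := fun n t => by
    rw [hg, le_div_iff₀ (by positivity)]
    exact (Nat.lt_floor_add_one _).le
  have hle : ∀ n t, g n t ≤ t + 1 / (n + 1) := fun n t => by
    rw [hg, div_le_iff₀ (by positivity), add_mul, one_div, inv_mul_cancel₀ (by positivity)]
    gcongr
    exact Nat.floor_le zero_le
  refine measurable_of_tendsto_metrizable (f := fun n (p : ℝ≥0 × Ω) => X (g n p.1) p.2)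
    (fun n => ?_) (tendsto_pi_nhds.2 fun p => ?_)
  · have h1 : Measurable fun q : ℕ × Ω => X (((q.1 : ℝ≥0) + 1) / (n + 1)) q.2 :=
      measurable_from_prod_countable_right fun m => hX ((m + 1) / (n + 1))
    have h2 : Measurable fun p : ℝ≥0 × Ω => (⌊p.1 * (n + 1)⌋₊, p.2) :=
      (Nat.measurable_floor.comp (by fun_prop)).prodMk measurable_snd
    have h3 := h1.comp h2
    simpa only [Function.comp_def, hg] using h3
  · have h1 : Tendsto (fun n => g n p.1) atTop (𝓝 p.1) := by
      refine tendsto_of_tendsto_of_tendsto_of_le_of_le tendsto_const_nhds ?_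
        (fun n => hlt n p.1) (fun n => hle n p.1)
      have := (tendsto_one_div_add_atTop_nhds_zero_nat (𝕜 := ℝ≥0)).const_add p.1
      simpa using this
    exact (hc p.2 p.1).1.tendsto.comp (tendsto_nhdsWithin_iff.2 ⟨h1, .of_forall fun n => hlt n p.1⟩)

theorem measurable_indicator_one_predictable {Ω : Type*} [mΩ : MeasurableSpace Ω]
    {𝓕 : Filtration ℝ≥0 mΩ} {D : Set (ℝ≥0 × Ω)} (hD : MeasurableSet[𝓕.predictable] D) :
    Measurable[𝓕.predictable] (D.indicator (1 : ℝ≥0 × Ω → ℝ≥0∞)) :=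
  Measurable.indicator (m := 𝓕.predictable) (@measurable_const _ _ _ 𝓕.predictable _) hD

/-! ### Event times, predictable sets and jump sums -/

namespace MarkedPointProcess

variable {Ω : Type*} [mΩ : MeasurableSpace Ω] {d : ℕ} (S : MarkedPointProcess Ω d)

theorem finite_events (k : Fin d) (t : ℝ≥0) (ω : Ω) : (S.events k t ω).Finite :=
  (S.finite_T ω t).subset fun _ hn => hn.1

theorem exists_lt_T (t : ℝ≥0) (ω : Ω) : ∃ n, (t : ℝ≥0∞) < S.T n ω := by
  by_contra! hc
  exact Set.infinite_univ ((S.finite_T ω t).subset fun n _ => hc n)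

theorem sum_count (t : ℝ≥0) (ω : Ω) : ∑ k, S.count k t ω = {n | S.T n ω ≤ t}.ncard := by
  classical
  rw [Set.ncard_eq_toFinset_card _ (S.finite_T ω t),
    Finset.card_eq_sum_card_fiberwise (f := fun n => S.X n ω) (t := Finset.univ)
      (fun _ _ => by simp)]
  refine Finset.sum_congr rfl fun k _ => ?_
  rw [count, Set.ncard_eq_toFinset_card _ (S.finite_events k t ω)]
  congr 1
  ext n
  simp [events]

/-- The times are ordered, so the indices of events up to `t` form an initial segment. This makes
each `{T n ≤ t}` belong to `𝓕 t` although only the counts are assumed adapted. -/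
theorem T_le_iff (n : ℕ) (t : ℝ≥0) (ω : Ω) : S.T n ω ≤ t ↔ n < ∑ k, S.count k t ω := by
  rw [sum_count]
  have hfin := S.finite_T ω t
  constructor
  · intro h
    have h1 : Set.Iic n ⊆ {m | S.T m ω ≤ t} := fun m hm => (S.monotone_T ω hm).trans h
    have h2 := Set.ncard_le_ncard h1 hfin
    rw [Set.ncard_eq_toFinset_card' (Set.Iic n)] at h2
    simp at h2
    omega
  · intro h
    by_contra hn
    have h1 : {m | S.T m ω ≤ t} ⊆ Set.Iio n := fun m hm => by
      by_contra hnm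
      exact hn ((S.monotone_T ω (not_lt.1 hnm)).trans hm)
    have h2 := Set.ncard_le_ncard h1 (Set.finite_Iio n)
    rw [Set.ncard_eq_toFinset_card' (Set.Iio n)] at h2
    simp at h2
    omega

theorem measurableSet_T_le {𝓕 : Filtration ℝ≥0 mΩ} (hS : ∀ k, Adapted 𝓕 (S.count k)) (n : ℕ)
    (t : ℝ≥0) : MeasurableSet[𝓕 t] {ω | S.T n ω ≤ t} := by
  simp only [T_le_iff]
  have h1 : Measurable[𝓕 t] fun ω => ∑ k, S.count k t ω :=
    Finset.measurable_fun_sum (m := 𝓕 t) _ fun k _ => hS k t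
  exact h1 (measurableSet_Ioi (a := n))

theorem measurableSet_predictable_le_T {𝓕 : Filtration ℝ≥0 mΩ}
    (hS : ∀ k, Adapted 𝓕 (S.count k)) (n : ℕ) :
    MeasurableSet[𝓕.predictable] {p : ℝ≥0 × Ω | (p.1 : ℝ≥0∞) ≤ S.T n p.2} := by
  -- `T n < s` holds iff some rational `q` satisfies `T n ≤ q < s`, so the complement is a countable
  -- union of predictable rectangles.
  have h1 : {p : ℝ≥0 × Ω | (p.1 : ℝ≥0∞) ≤ S.T n p.2} =
      (⋃ q : ℚ, Set.Ioi (Real.toNNReal q) ×ˢ {ω | S.T n ω ≤ (Real.toNNReal q : ℝ≥0)})ᶜ := by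
    ext ⟨s, ω⟩
    simp only [Set.mem_ofPred_eq, Set.mem_compl_iff, Set.mem_iUnion, Set.mem_prod, Set.mem_Ioi,
      not_exists, not_and, not_le]
    constructor
    · intro h q hq
      exact (ENNReal.coe_lt_coe.2 hq).trans_le h
    · intro h
      by_contra! hlt
      obtain ⟨q, -, hq1, hq2⟩ := ENNReal.lt_iff_exists_rat_btwn.1 hlt
      exact (h q (ENNReal.coe_lt_coe.1 hq2)).not_ge hq1.le
  rw [h1]
  exact (MeasurableSet.iUnion fun q =>
    measurableSet_predictable_Ioi_prod (S.measurableSet_T_le hS n _)).compl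

theorem measurableSet_predictable_le {𝓕 : Filtration ℝ≥0 mΩ} (t : ℝ≥0) :
    MeasurableSet[𝓕.predictable] {p : ℝ≥0 × Ω | p.1 ≤ t} := by
  have h1 : {p : ℝ≥0 × Ω | p.1 ≤ t} = (Set.Ioi t ×ˢ (Set.univ : Set Ω))ᶜ := by
    ext p; simp
  rw [h1]
  exact (measurableSet_predictable_Ioi_prod MeasurableSet.univ).compl

theorem measurableSet_event (k : Fin d) (t : ℝ≥0) (n : ℕ) :
    MeasurableSet {ω | n ∈ S.events k t ω} :=
  (measurableSet_le (S.measurable_T n) measurable_const).inter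
    (S.measurable_X n (measurableSet_singleton k))

theorem ofReal_jumpSum (k : Fin d) (t : ℝ≥0) (ω : Ω) :
    ENNReal.ofReal (S.jumpSum t ω k) =
      ∑' n, (S.events k t ω).indicator (fun n => ENNReal.ofReal (S.Y k n ω)) n := by
  rw [jumpSum, ENNReal.ofReal_tsum_of_nonneg]
  · refine tsum_congr fun n => ?_
    by_cases hn : n ∈ S.events k t ω <;> simp [hn]
  · exact fun n => Set.indicator_nonneg (fun m _ => S.nonneg_Y k m ω) n
  · refine summable_of_hasFiniteSupport ((S.finite_events k t ω).subset ?_)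
    exact Set.support_indicator_subset

theorem jumpSum_nonneg (k : Fin d) (t : ℝ≥0) (ω : Ω) : 0 ≤ S.jumpSum t ω k :=
  tsum_nonneg fun n => Set.indicator_nonneg (fun m _ => S.nonneg_Y k m ω) n

theorem ofReal_jumpSum_of_lt_T {n : ℕ} {t : ℝ≥0} {ω : Ω} (h : (t : ℝ≥0∞) < S.T n ω)
    (k : Fin d) :
    ENNReal.ofReal (S.jumpSum t ω k) =
      ∑ m ∈ Finset.range n,
        (S.events k t ω).indicator (fun m => ENNReal.ofReal (S.Y k m ω)) m := by
  rw [ofReal_jumpSum]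
  refine tsum_eq_sum fun m hm => Set.indicator_of_notMem (fun hme => ?_) _
  have h1 : n ≤ m := by simpa using hm
  exact (h.trans_le (S.monotone_T ω h1)).not_ge hme.1

theorem enorm_jumpSum_le (t : ℝ≥0) (ω : Ω) :
    ‖S.jumpSum t ω‖ₑ ≤ ∑ k, ENNReal.ofReal (S.jumpSum t ω k) := by
  rw [← ENNReal.ofReal_sum_of_nonneg fun k _ => S.jumpSum_nonneg k t ω, ← ofReal_norm]
  refine ENNReal.ofReal_le_ofReal ((pi_norm_le_iff_of_nonneg
    (Finset.sum_nonneg fun k _ => S.jumpSum_nonneg k t ω)).2 fun k => ?_)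
  rw [Real.norm_of_nonneg (S.jumpSum_nonneg k t ω)]
  exact Finset.single_le_sum (f := fun k => S.jumpSum t ω k)
    (fun j _ => S.jumpSum_nonneg j t ω) (Finset.mem_univ k)

end MarkedPointProcess

/-! ### Expected counts and expected jump sums -/

namespace IsSDEDrivenSelfExciting

variable {Ω : Type*} [mΩ : MeasurableSpace Ω] {P : Measure Ω}
  {𝓕 : Filtration ℝ≥0 mΩ} {d : ℕ} {μ : ℝ → (Fin d → ℝ) → (Fin d → ℝ)}
  {B : Matrix (Fin d) (Fin d) ℝ} {x : Fin d → ℝ}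
  {S : MarkedPointProcess Ω d} {lam : ℝ≥0 → Ω → (Fin d → ℝ)}

theorem measurable_uncurry_lam {ν : Fin d → Kernel (Fin d → ℝ) ℝ}
    (h : IsSDEDrivenSelfExciting P 𝓕 μ B ν x S lam) :
    Measurable fun p : ℝ × Ω => lam p.1.toNNReal p.2 :=
  (measurable_uncurry_of_isCadlagPath (fun t => (h.adapted_lam t).mono (𝓕.le t) le_rfl)
    h.cadlag_lam).comp (by fun_prop : Measurable fun p : ℝ × Ω => (p.1.toNNReal, p.2))

theorem lintegral_enorm_lam_ne_top {ν : Fin d → Kernel (Fin d → ℝ) ℝ}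
    (h : IsSDEDrivenSelfExciting P 𝓕 μ B ν x S lam) (ω : Ω) (T : ℝ) :
    ∫⁻ s in Set.Ioc 0 T, ‖lam s.toNNReal ω‖ₑ ≠ ∞ := by
  obtain ⟨C, hC⟩ := (h.cadlag_lam ω).exists_nnnorm_le T.toNNReal
  refine ne_top_of_le_ne_top (b := C * volume (Set.Ioc 0 T))
    (ENNReal.mul_ne_top ENNReal.coe_ne_top measure_Ioc_lt_top.ne) ?_
  rw [← setLIntegral_const]
  refine setLIntegral_mono' measurableSet_Ioc fun s hs => ?_
  rw [enorm_eq_nnnorm]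
  exact_mod_cast hC _ (Real.toNNReal_le_toNNReal hs.2)

theorem integrableOn_lam {ν : Fin d → Kernel (Fin d → ℝ) ℝ}
    (h : IsSDEDrivenSelfExciting P 𝓕 μ B ν x S lam) (ω : Ω) (T : ℝ) :
    IntegrableOn (fun s : ℝ => lam s.toNNReal ω) (Set.Ioc 0 T) :=
  ⟨(h.measurable_uncurry_lam.comp measurable_prodMk_right).aestronglyMeasurable,
    (h.lintegral_enorm_lam_ne_top ω T).lt_top⟩

/-- The intensity formula on `[0, t]`. -/
theorem tsum_measure_event {ν : Fin d → Kernel (Fin d → ℝ) ℝ}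
    (h : IsSDEDrivenSelfExciting P 𝓕 μ B ν x S lam) (k : Fin d) (t : ℝ≥0) :
    ∑' n, P {ω | n ∈ S.events k t ω} =
      ∫⁻ ω, (∫⁻ s in Set.Ioc (0 : ℝ) t, ENNReal.ofReal (lam s.toNNReal ω k)) ∂P := by
  have h1 := h.intensity k ({p : ℝ≥0 × Ω | p.1 ≤ t}.indicator 1)
    (measurable_indicator_one_predictable (MarkedPointProcess.measurableSet_predictable_le t))
  have h2 : ∀ ω, S.countIntegral k ({p : ℝ≥0 × Ω | p.1 ≤ t}.indicator 1) ω =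
      ∑' n, {ω | n ∈ S.events k t ω}.indicator 1 ω := fun ω => by
    refine tsum_congr fun n => ?_
    simp only [Set.indicator_apply, Set.mem_ofPred_eq, MarkedPointProcess.events, Pi.one_apply]
    -- `toNNReal` sends `∞` to `0`, which would pass the test `≤ t`; such indices are excluded by
    -- `countIntegral` itself.
    by_cases ht : S.T n ω < ∞
    · have h3 : (S.T n ω).toNNReal ≤ t ↔ S.T n ω ≤ t := by
        rw [← ENNReal.coe_le_coe, ENNReal.coe_toNNReal ht.ne]
      by_cases hX : S.X n ω = k <;> simp [ht, hX, h3]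
    · have h4 : S.T n ω = ∞ := by simpa using ht
      simp [h4]
  simp only [h2] at h1
  rw [lintegral_tsum fun n =>
    (measurable_one.indicator (S.measurableSet_event k t n)).aemeasurable] at h1
  simp only [lintegral_indicator_one (S.measurableSet_event k t _)] at h1
  rw [h1]
  refine lintegral_congr fun ω => ?_
  rw [setLIntegral_congr (Ioc_ae_eq_Icc : Set.Ioc (0 : ℝ) t =ᵐ[volume] _),
    ← lintegral_indicator measurableSet_Ici, ← lintegral_indicator measurableSet_Icc]
  refine lintegral_congr fun s => ?_
  by_cases hs : 0 ≤ s
  · by_cases hst : s ≤ t <;> simp [hs, hst, Real.toNNReal_le_iff_le_coe]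
  · simp [hs]

/-- The intensity formula on the part of `[0, t]` before the `n`-th event. -/
theorem sum_measure_event_le {ν : Fin d → Kernel (Fin d → ℝ) ℝ}
    (h : IsSDEDrivenSelfExciting P 𝓕 μ B ν x S lam) (k : Fin d) (t : ℝ≥0) (n : ℕ) :
    ∑ m ∈ Finset.range n, P {ω | m ∈ S.events k t ω} ≤
      ∫⁻ ω, (∫⁻ s in Set.Ioc (0 : ℝ) t, {s | ENNReal.ofReal s < S.T n ω}.indicator
        (fun s => ENNReal.ofReal (lam s.toNNReal ω k)) s) ∂P := by
  -- The predictable interval is closed at `T n`. It catches all events of index below `n`, and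
  -- possibly others at time `T n`, hence only an inequality; the endpoint is Lebesgue-null on the
  -- intensity side.
  set D : Set (ℝ≥0 × Ω) := {p | p.1 ≤ t} ∩ {p | (p.1 : ℝ≥0∞) ≤ S.T n p.2} with hD
  have h1 := h.intensity k (D.indicator 1)
    (measurable_indicator_one_predictable ((MarkedPointProcess.measurableSet_predictable_le t).inter
      (S.measurableSet_predictable_le_T h.adapted_count n)))
  have h2 : ∀ ω, ∑ m ∈ Finset.range n, {ω | m ∈ S.events k t ω}.indicator 1 ω ≤
      S.countIntegral k (D.indicator 1) ω := fun ω => by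
    refine le_trans (Finset.sum_le_sum fun m hm => ?_) (ENNReal.sum_le_tsum (Finset.range n))
    refine Set.indicator_apply_le' (fun hme => ?_) fun _ => zero_le
    have ht : S.T m ω < ∞ := hme.1.trans_lt ENNReal.coe_lt_top
    rw [Set.indicator_of_mem (show m ∈ {n | S.T n ω < ∞ ∧ S.X n ω = k} from ⟨ht, hme.2⟩),
      Set.indicator_of_mem]
    · rfl
    · have h3 : (S.T m ω).toNNReal ≤ t := by
        rw [← ENNReal.coe_le_coe, ENNReal.coe_toNNReal ht.ne]
        exact hme.1
      refine ⟨h3, ?_⟩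
      simp only [Set.mem_ofPred_eq, ENNReal.coe_toNNReal ht.ne]
      exact S.monotone_T ω (Finset.mem_range.1 hm).le
  calc ∑ m ∈ Finset.range n, P {ω | m ∈ S.events k t ω}
      = ∫⁻ ω, ∑ m ∈ Finset.range n, {ω | m ∈ S.events k t ω}.indicator 1 ω ∂P := by
        rw [lintegral_finsetSum _ fun m _ =>
          measurable_one.indicator (S.measurableSet_event k t m)]
        simp only [lintegral_indicator_one (S.measurableSet_event k t _)]
    _ ≤ _ := lintegral_mono h2
    _ = _ := h1
    _ ≤ _ := by
      refine lintegral_mono fun ω => ?_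
      rw [← lintegral_indicator measurableSet_Ici, ← lintegral_indicator measurableSet_Ioc]
      refine lintegral_mono_ae ?_
      filter_upwards [measure_singleton (μ := (volume : Measure ℝ)) 0 |>
        (compl_mem_ae_iff.2 ·), measure_singleton (μ := (volume : Measure ℝ))
        (S.T n ω).toReal |> (compl_mem_ae_iff.2 ·)] with s hs0 hsT
      refine Set.indicator_apply_le' (fun hs => ?_) fun _ => zero_le
      have hs' : 0 < s := lt_of_le_of_ne hs (Ne.symm hs0)
      by_cases hsD : (s.toNNReal, ω) ∈ D
      · have h3 : s ≤ t := by
          have : s.toNNReal ≤ t := hsD.1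
          rwa [Real.toNNReal_le_iff_le_coe] at this
        have h4 : ENNReal.ofReal s < S.T n ω := by
          refine lt_of_le_of_ne hsD.2 fun heq => hsT ?_
          rw [Set.mem_singleton_iff, ← heq, ENNReal.toReal_ofReal hs]
        rw [Set.indicator_of_mem hsD, Set.indicator_of_mem (show s ∈ Set.Ioc 0 (t : ℝ) from
          ⟨hs', h3⟩), Set.indicator_of_mem (show s ∈ {s | ENNReal.ofReal s < S.T n ω} from h4)]
        simp
      · rw [Set.indicator_of_notMem hsD]
        simp

variable {ν : Fin d → Measure ℝ}

theorem map_jump [∀ k, IsProbabilityMeasure (ν k)]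
    (h : IsSDEDrivenSelfExciting P 𝓕 μ B (fun k => Kernel.const (Fin d → ℝ) (ν k)) x S lam)
    (k : Fin d) (t : ℝ≥0) (n : ℕ) :
    (P.restrict {ω | n ∈ S.events k t ω}).map (S.Y k n) =
      P {ω | n ∈ S.events k t ω} • ν k := by
  -- `{T n ≤ t}` is strictly prior because its complement `{t < T n}` is a generator; thus
  -- `jump_law` applies to it.
  have hG : MeasurableSet[strictlyPrior 𝓕 (S.T n)] {ω | S.T n ω ≤ t} := by
    have h1 : MeasurableSet[strictlyPrior 𝓕 (S.T n)] {ω | (t : ℝ≥0∞) < S.T n ω} := by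
      refine le_sup_right (a := 𝓕 0) _ (MeasurableSpace.measurableSet_generateFrom
        ⟨t, Set.univ, MeasurableSet.univ, by simp⟩)
    convert h1.compl using 1
    ext ω; simp
  ext C hC
  have h1 := h.jump_law n k _ hG C hC
  simp only [Kernel.const_apply, setLIntegral_const] at h1
  have h2 : {ω | S.T n ω ≤ t} ∩ {ω | S.T n ω < ∞ ∧ S.X n ω = k} =
      {ω | n ∈ S.events k t ω} := by
    ext ω
    simp only [Set.mem_inter_iff, Set.mem_ofPred_eq, MarkedPointProcess.events]
    exact ⟨fun H => ⟨H.1, H.2.2⟩, fun H => ⟨H.1, H.1.trans_lt ENNReal.coe_lt_top, H.2⟩⟩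
  have h3 : {ω | S.T n ω ≤ t} ∩ {ω | S.T n ω < ∞ ∧ S.X n ω = k ∧ S.Y k n ω ∈ C} =
      S.Y k n ⁻¹' C ∩ {ω | n ∈ S.events k t ω} := by
    rw [← h2]
    ext ω
    simp only [Set.mem_inter_iff, Set.mem_ofPred_eq, Set.mem_preimage]
    tauto
  rw [h2, h3] at h1
  rw [Measure.map_apply (S.measurable_Y k n) hC,
    Measure.restrict_apply (S.measurable_Y k n hC), h1, Measure.smul_apply, smul_eq_mul, mul_comm]

theorem lintegral_jump [∀ k, IsProbabilityMeasure (ν k)]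
    (h : IsSDEDrivenSelfExciting P 𝓕 μ B (fun k => Kernel.const (Fin d → ℝ) (ν k)) x S lam)
    (k : Fin d) (t : ℝ≥0) (n : ℕ) :
    ∫⁻ ω, (S.events k t ω).indicator (fun n => ENNReal.ofReal (S.Y k n ω)) n ∂P =
      (∫⁻ y, ENNReal.ofReal y ∂ν k) * P {ω | n ∈ S.events k t ω} := by
  have h1 : ∫⁻ ω, (S.events k t ω).indicator (fun n => ENNReal.ofReal (S.Y k n ω)) n ∂P =
      ∫⁻ ω in {ω | n ∈ S.events k t ω}, ENNReal.ofReal (S.Y k n ω) ∂P := by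
    rw [← lintegral_indicator (S.measurableSet_event k t n)]
    refine lintegral_congr fun ω => ?_
    by_cases hn : n ∈ S.events k t ω <;> simp [hn]
  rw [h1, ← lintegral_map (f := fun y => ENNReal.ofReal y) (by fun_prop) (S.measurable_Y k n),
    h.map_jump, lintegral_smul_measure, smul_eq_mul, mul_comm]

theorem ae_nonneg_of_measure_event_ne_zero [∀ k, IsProbabilityMeasure (ν k)]
    (h : IsSDEDrivenSelfExciting P 𝓕 μ B (fun k => Kernel.const (Fin d → ℝ) (ν k)) x S lam)
    {k : Fin d} {t : ℝ≥0} {n : ℕ} (hn : P {ω | n ∈ S.events k t ω} ≠ 0) :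
    ∀ᵐ y ∂ν k, 0 ≤ y := by
  have h1 : ∀ᵐ y ∂(P.restrict {ω | n ∈ S.events k t ω}).map (S.Y k n), 0 ≤ y :=
    (ae_map_iff (S.measurable_Y k n).aemeasurable measurableSet_Ici).2
      (ae_of_all _ fun ω => S.nonneg_Y k n ω)
  rw [h.map_jump] at h1
  exact (Measure.ae_ennreal_smul_measure_iff hn).1 h1

/-- The expected value of `U_k(t)` is the mean jump size times that of `N_k(t)`. -/
theorem lintegral_jumpSum [∀ k, IsProbabilityMeasure (ν k)]
    (h : IsSDEDrivenSelfExciting P 𝓕 μ B (fun k => Kernel.const (Fin d → ℝ) (ν k)) x S lam)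
    (k : Fin d) (t : ℝ≥0) :
    ∫⁻ ω, ENNReal.ofReal (S.jumpSum t ω k) ∂P =
      (∫⁻ y, ENNReal.ofReal y ∂ν k) *
        ∫⁻ ω, (∫⁻ s in Set.Ioc (0 : ℝ) t, ENNReal.ofReal (lam s.toNNReal ω k)) ∂P := by
  have hm : ∀ n, Measurable fun ω =>
      (S.events k t ω).indicator (fun n => ENNReal.ofReal (S.Y k n ω)) n := fun n =>
    (S.measurable_Y k n).ennreal_ofReal.indicator (S.measurableSet_event k t n)
  simp only [S.ofReal_jumpSum]
  rw [lintegral_tsum fun n => (hm n).aemeasurable, ← h.tsum_measure_event]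
  simp only [h.lintegral_jump, ENNReal.tsum_mul_left]

theorem lintegral_sum_jump_le [∀ k, IsProbabilityMeasure (ν k)]
    (h : IsSDEDrivenSelfExciting P 𝓕 μ B (fun k => Kernel.const (Fin d → ℝ) (ν k)) x S lam)
    (k : Fin d) (t : ℝ≥0) (n : ℕ) :
    ∫⁻ ω, ∑ m ∈ Finset.range n,
        (S.events k t ω).indicator (fun m => ENNReal.ofReal (S.Y k m ω)) m ∂P ≤
      (∫⁻ y, ENNReal.ofReal y ∂ν k) *
        ∫⁻ ω, (∫⁻ s in Set.Ioc (0 : ℝ) t, {s | ENNReal.ofReal s < S.T n ω}.indicator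
          (fun s => ENNReal.ofReal (lam s.toNNReal ω k)) s) ∂P := by
  have hm : ∀ n, Measurable fun ω =>
      (S.events k t ω).indicator (fun n => ENNReal.ofReal (S.Y k n ω)) n := fun n =>
    (S.measurable_Y k n).ennreal_ofReal.indicator (S.measurableSet_event k t n)
  rw [lintegral_finsetSum _ fun m _ => hm m]
  simp only [h.lintegral_jump, ← Finset.mul_sum]
  exact mul_le_mul_right (h.sum_measure_event_le k t n) _

end IsSDEDrivenSelfExciting

/-! ### Localisation before the `n`-th event and moment bounds -/

/-- The norm of `lam s` before the `n`-th event, continued by `0`. -/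
noncomputable def MarkedPointProcess.normBefore {Ω : Type*} [MeasurableSpace Ω] {d : ℕ}
    (S : MarkedPointProcess Ω d) (lam : ℝ≥0 → Ω → (Fin d → ℝ)) (n : ℕ) (s : ℝ) (ω : Ω) : ℝ≥0∞ :=
  {s : ℝ | ENNReal.ofReal s < S.T n ω}.indicator (fun s => ‖lam s.toNNReal ω‖ₑ) s

theorem Matrix.integrable_mulVec {α : Type*} [MeasurableSpace α] {ρ : Measure α} {d : ℕ}
    (M : Matrix (Fin d) (Fin d) ℝ) {f : α → Fin d → ℝ} (hf : Integrable f ρ) :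
    Integrable (fun y => M *ᵥ f y) ρ :=
  (Matrix.mulVecLin M).toContinuousLinearMap.integrable_comp hf

theorem Matrix.integral_mulVec {α : Type*} [MeasurableSpace α] {ρ : Measure α} {d : ℕ}
    (M : Matrix (Fin d) (Fin d) ℝ) {f : α → Fin d → ℝ} (hf : Integrable f ρ) :
    ∫ y, M *ᵥ f y ∂ρ = M *ᵥ ∫ y, f y ∂ρ :=
  (Matrix.mulVecLin M).toContinuousLinearMap.integral_comp_comm hf

namespace IsSDEDrivenSelfExciting

variable {Ω : Type*} [mΩ : MeasurableSpace Ω] {P : Measure Ω}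
  {𝓕 : Filtration ℝ≥0 mΩ} {d : ℕ} {A B : Matrix (Fin d) (Fin d) ℝ} {lam0 x : Fin d → ℝ}
  {S : MarkedPointProcess Ω d} {lam : ℝ≥0 → Ω → (Fin d → ℝ)}

theorem measurable_normBefore {μ : ℝ → (Fin d → ℝ) → (Fin d → ℝ)}
    {ν : Fin d → Kernel (Fin d → ℝ) ℝ} (h : IsSDEDrivenSelfExciting P 𝓕 μ B ν x S lam) (n : ℕ) :
    Measurable fun p : ℝ × Ω => S.normBefore lam n p.1 p.2 :=
  h.measurable_uncurry_lam.enorm.indicator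
    (s := {p : ℝ × Ω | ENNReal.ofReal p.1 < S.T n p.2})
    (measurableSet_lt (by fun_prop) ((S.measurable_T n).comp measurable_snd))

theorem lam_eq {ν : Fin d → Kernel (Fin d → ℝ) ℝ}
    (h : IsSDEDrivenSelfExciting P 𝓕 (linearDrift A lam0) B ν x S lam) :
    ∀ᵐ ω ∂P, ∀ t : ℝ≥0, lam t ω =
      x + A *ᵥ ((∫ s in Set.Ioc (0 : ℝ) t, lam s.toNNReal ω) - (t : ℝ) • lam0) +
        B *ᵥ S.jumpSum t ω := by
  filter_upwards [h.initial, h.sde] with ω h0 hsde t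
  rw [hsde t, h0, intervalIntegral.integral_of_le t.coe_nonneg]
  congr 2
  have h1 := A.integral_mulVec (f := fun s : ℝ => lam s.toNNReal ω - lam0)
    ((h.integrableOn_lam ω t).sub (integrable_const lam0))
  rw [integral_sub (h.integrableOn_lam ω t) (integrable_const lam0)] at h1
  simpa [linearDrift] using h1

theorem enorm_lam_le {ν : Fin d → Kernel (Fin d → ℝ) ℝ}
    (h : IsSDEDrivenSelfExciting P 𝓕 (linearDrift A lam0) B ν x S lam) {a b : ℝ≥0}
    (ha : ∀ v, ‖A *ᵥ v‖ₑ ≤ a * ‖v‖ₑ) (hb : ∀ v, ‖B *ᵥ v‖ₑ ≤ b * ‖v‖ₑ) :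
    ∀ᵐ ω ∂P, ∀ t : ℝ≥0, ‖lam t ω‖ₑ ≤
      (‖x‖ₑ + a * (t * ‖lam0‖ₑ) + b * ∑ k, ENNReal.ofReal (S.jumpSum t ω k)) +
        a * ∫⁻ s in Set.Ioc (0 : ℝ) t, ‖lam s.toNNReal ω‖ₑ := by
  filter_upwards [h.lam_eq] with ω hω t
  have h1 : ‖(∫ s in Set.Ioc (0 : ℝ) t, lam s.toNNReal ω) - (t : ℝ) • lam0‖ₑ ≤
      (∫⁻ s in Set.Ioc (0 : ℝ) t, ‖lam s.toNNReal ω‖ₑ) + t * ‖lam0‖ₑ := by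
    refine (enorm_sub_le).trans (add_le_add (enorm_integral_le_lintegral_enorm _) ?_)
    rw [enorm_smul]
    simp
  calc ‖lam t ω‖ₑ
      ≤ ‖x‖ₑ + ‖A *ᵥ ((∫ s in Set.Ioc (0 : ℝ) t, lam s.toNNReal ω) - (t : ℝ) • lam0)‖ₑ +
        ‖B *ᵥ S.jumpSum t ω‖ₑ := by
        rw [hω t]
        exact (enorm_add_le _ _).trans (add_le_add_left (enorm_add_le _ _) _)
    _ ≤ ‖x‖ₑ + a * ((∫⁻ s in Set.Ioc (0 : ℝ) t, ‖lam s.toNNReal ω‖ₑ) + t * ‖lam0‖ₑ) +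
        b * ∑ k, ENNReal.ofReal (S.jumpSum t ω k) :=
        add_le_add (add_le_add le_rfl ((ha _).trans (mul_le_mul_right h1 _)))
          ((hb _).trans (mul_le_mul_right (S.enorm_jumpSum_le t ω) _))
    _ = _ := by ring

/-- For `t < T n` only the first `n` jumps can have occurred, and for later `t` the left side is
`0`. The bound thus closes up in `normBefore` with a finite sum of jumps. -/
theorem normBefore_le {ν : Fin d → Kernel (Fin d → ℝ) ℝ}
    (h : IsSDEDrivenSelfExciting P 𝓕 (linearDrift A lam0) B ν x S lam) {a b : ℝ≥0}
    (ha : ∀ v, ‖A *ᵥ v‖ₑ ≤ a * ‖v‖ₑ) (hb : ∀ v, ‖B *ᵥ v‖ₑ ≤ b * ‖v‖ₑ) (n : ℕ) :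
    ∀ᵐ ω ∂P, ∀ t : ℝ≥0, S.normBefore lam n t ω ≤
      (‖x‖ₑ + a * (t * ‖lam0‖ₑ) + b * ∑ k, ∑ m ∈ Finset.range n,
        (S.events k t ω).indicator (fun m => ENNReal.ofReal (S.Y k m ω)) m) +
        a * ∫⁻ s in Set.Ioc (0 : ℝ) t, S.normBefore lam n s ω := by
  filter_upwards [h.enorm_lam_le ha hb] with ω hω t
  refine Set.indicator_apply_le' (fun ht => ?_) fun _ => zero_le
  have ht' : (t : ℝ≥0∞) < S.T n ω := by simpa using ht
  have h1 := hω t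
  simp only [S.ofReal_jumpSum_of_lt_T ht'] at h1
  rw [Real.toNNReal_coe]
  refine h1.trans (add_le_add le_rfl (mul_le_mul_right ?_ _))
  refine setLIntegral_mono' measurableSet_Ioc fun s hs => ?_
  rw [MarkedPointProcess.normBefore, Set.indicator_of_mem]
  refine lt_of_le_of_lt ?_ ht'
  rw [← ENNReal.ofReal_coe_nnreal]
  exact ENNReal.ofReal_le_ofReal hs.2

variable {ν : Fin d → Measure ℝ}

theorem lintegral_normBefore_ne_top [IsProbabilityMeasure P] [∀ k, IsProbabilityMeasure (ν k)]
    (hmean : ∀ k, Integrable (fun y : ℝ => y) (ν k))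
    (h : IsSDEDrivenSelfExciting P 𝓕 (linearDrift A lam0) B
      (fun k => Kernel.const (Fin d → ℝ) (ν k)) x S lam) (n : ℕ) (T : ℝ≥0) :
    ∫⁻ ω, (∫⁻ s in Set.Ioc (0 : ℝ) T, S.normBefore lam n s ω) ∂P ≠ ∞ := by
  obtain ⟨a, ha⟩ := A.exists_enorm_mulVec_le
  obtain ⟨b, hb⟩ := B.exists_enorm_mulVec_le
  obtain ⟨C, hC⟩ := exists_lintegral_le_of_le_add_lintegral a T
  -- Grönwall needs a constant free term, so the jumps, which accumulate with time, are taken at the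
  -- final time `T`.
  set J : Ω → ℝ≥0∞ := fun ω => ∑ k, ∑ m ∈ Finset.range n,
    (S.events k T ω).indicator (fun m => ENNReal.ofReal (S.Y k m ω)) m with hJ
  have hJm : ∀ k m, Measurable fun ω =>
      (S.events k T ω).indicator (fun m => ENNReal.ofReal (S.Y k m ω)) m := fun k m =>
    (S.measurable_Y k m).ennreal_ofReal.indicator (S.measurableSet_event k T m)
  have hJfin : ∫⁻ ω, J ω ∂P ≠ ∞ := by
    rw [hJ, lintegral_finsetSum _ fun k _ => Finset.measurable_fun_sum _ fun m _ => hJm k m]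
    refine ENNReal.sum_ne_top.2 fun k _ => ?_
    rw [lintegral_finsetSum _ fun m _ => hJm k m]
    refine ENNReal.sum_ne_top.2 fun m _ => ?_
    rw [h.lintegral_jump]
    exact ENNReal.mul_ne_top (hmean k).lintegral_lt_top.ne (measure_ne_top _ _)
  have hle : ∀ᵐ ω ∂P, ∫⁻ s in Set.Ioc (0 : ℝ) T, S.normBefore lam n s ω ≤
      C * (‖x‖ₑ + a * (T * ‖lam0‖ₑ) + b * J ω) := by
    filter_upwards [h.normBefore_le ha hb n] with ω hω
    refine hC _ ((h.measurable_normBefore n).comp measurable_prodMk_right) _ (fun t ht => ?_) ?_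
    · have h1 := hω t.toNNReal
      rw [Real.coe_toNNReal t ht.1.le] at h1
      have htT : t.toNNReal ≤ T := Real.toNNReal_le_iff_le_coe.2 ht.2
      refine h1.trans (add_le_add (add_le_add (add_le_add le_rfl ?_) ?_) le_rfl)
      · gcongr
      · refine mul_le_mul_right (Finset.sum_le_sum fun k _ => Finset.sum_le_sum fun m _ => ?_) _
        refine Set.indicator_le_indicator_of_subset (fun m hm =>
          (⟨le_trans hm.1 (ENNReal.coe_le_coe.2 htT), hm.2⟩ : _ ∧ _)) (fun _ => zero_le) _
    · refine ne_top_of_le_ne_top (h.lintegral_enorm_lam_ne_top ω T) (lintegral_mono fun s => ?_)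
      exact Set.indicator_le_self' (f := fun s : ℝ => ‖lam s.toNNReal ω‖ₑ)
        (fun _ _ => zero_le) s
  refine ne_top_of_le_ne_top ?_ (lintegral_mono_ae hle)
  rw [lintegral_const_mul' _ _ ENNReal.coe_ne_top, lintegral_add_left measurable_const,
    lintegral_const_mul' _ _ ENNReal.coe_ne_top, lintegral_const, measure_univ, mul_one]
  finiteness

/-- The jump terms are traded for the intensity, so the constants no longer depend on `n`. -/
theorem lintegral_normBefore_le [IsProbabilityMeasure P] [∀ k, IsProbabilityMeasure (ν k)]
    (h : IsSDEDrivenSelfExciting P 𝓕 (linearDrift A lam0) B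
      (fun k => Kernel.const (Fin d → ℝ) (ν k)) x S lam) {a b : ℝ≥0}
    (ha : ∀ v, ‖A *ᵥ v‖ₑ ≤ a * ‖v‖ₑ) (hb : ∀ v, ‖B *ᵥ v‖ₑ ≤ b * ‖v‖ₑ) (n : ℕ) (t : ℝ≥0) :
    ∫⁻ ω, S.normBefore lam n t ω ∂P ≤ ‖x‖ₑ + a * (t * ‖lam0‖ₑ) +
      (a + b * ∑ k, ∫⁻ y, ENNReal.ofReal y ∂ν k) *
        ∫⁻ s in Set.Ioc (0 : ℝ) t, ∫⁻ ω, S.normBefore lam n s ω ∂P := by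
  have hswap : ∫⁻ s in Set.Ioc (0 : ℝ) t, ∫⁻ ω, S.normBefore lam n s ω ∂P =
      ∫⁻ ω, (∫⁻ s in Set.Ioc (0 : ℝ) t, S.normBefore lam n s ω) ∂P :=
    lintegral_lintegral_swap (h.measurable_normBefore n).aemeasurable
  have hJm : ∀ k m, Measurable fun ω =>
      (S.events k t ω).indicator (fun m => ENNReal.ofReal (S.Y k m ω)) m := fun k m =>
    (S.measurable_Y k m).ennreal_ofReal.indicator (S.measurableSet_event k t m)
  have hJ : Measurable fun ω => ∑ k, ∑ m ∈ Finset.range n,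
      (S.events k t ω).indicator (fun m => ENNReal.ofReal (S.Y k m ω)) m :=
    Finset.measurable_fun_sum _ fun k _ => Finset.measurable_fun_sum _ fun m _ => hJm k m
  have hk : ∀ k, ∫⁻ ω, (∫⁻ s in Set.Ioc (0 : ℝ) t, {s | ENNReal.ofReal s < S.T n ω}.indicator
      (fun s => ENNReal.ofReal (lam s.toNNReal ω k)) s) ∂P ≤
        ∫⁻ ω, (∫⁻ s in Set.Ioc (0 : ℝ) t, S.normBefore lam n s ω) ∂P := fun k => by
    refine lintegral_mono fun ω => lintegral_mono fun s => Set.indicator_le_indicator ?_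
    rw [← ofReal_norm]
    exact ENNReal.ofReal_le_ofReal ((le_abs_self _).trans (norm_le_pi_norm (lam _ ω) k))
  refine (lintegral_mono_ae ((h.normBefore_le ha hb n).mono fun ω hω => hω t)).trans ?_
  rw [lintegral_add_left (by fun_prop), lintegral_add_left measurable_const,
    lintegral_const_mul' _ _ ENNReal.coe_ne_top, lintegral_const_mul' _ _ ENNReal.coe_ne_top,
    lintegral_const, measure_univ, mul_one,
    lintegral_finsetSum _ fun k _ => Finset.measurable_fun_sum _ fun m _ => hJm k m, hswap]
  calc _ ≤ ‖x‖ₑ + a * (t * ‖lam0‖ₑ) + b * ∑ k, (∫⁻ y, ENNReal.ofReal y ∂ν k) *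
          ∫⁻ ω, (∫⁻ s in Set.Ioc (0 : ℝ) t, S.normBefore lam n s ω) ∂P +
        a * ∫⁻ ω, (∫⁻ s in Set.Ioc (0 : ℝ) t, S.normBefore lam n s ω) ∂P :=
        add_le_add (add_le_add le_rfl (mul_le_mul_right (Finset.sum_le_sum fun k _ =>
          (h.lintegral_sum_jump_le k t n).trans (mul_le_mul_right (hk k) _)) _)) le_rfl
    _ = _ := by
      rw [← Finset.sum_mul]
      ring

/-- The first moments of `lam` are bounded on bounded time intervals. -/
theorem exists_lintegral_enorm_lam_le [IsProbabilityMeasure P] [∀ k, IsProbabilityMeasure (ν k)]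
    (hmean : ∀ k, Integrable (fun y : ℝ => y) (ν k))
    (h : IsSDEDrivenSelfExciting P 𝓕 (linearDrift A lam0) B
      (fun k => Kernel.const (Fin d → ℝ) (ν k)) x S lam) (T : ℝ≥0) :
    ∃ D : ℝ≥0, ∀ t ≤ T, ∫⁻ ω, ‖lam t ω‖ₑ ∂P ≤ D := by
  obtain ⟨a, ha⟩ := A.exists_enorm_mulVec_le
  obtain ⟨b, hb⟩ := B.exists_enorm_mulVec_le
  have hκ : a + b * ∑ k, ∫⁻ y, ENNReal.ofReal y ∂ν k ≠ ∞ :=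
    ENNReal.add_ne_top.2 ⟨ENNReal.coe_ne_top, ENNReal.mul_ne_top ENNReal.coe_ne_top
      (ENNReal.sum_ne_top.2 fun k _ => (hmean k).lintegral_lt_top.ne)⟩
  have hbound := fun n t => h.lintegral_normBefore_le ha hb n t
  lift (a + b * ∑ k, ∫⁻ y, ENNReal.ofReal y ∂ν k : ℝ≥0∞) to ℝ≥0 using hκ with κ
  obtain ⟨C, hC⟩ := exists_lintegral_le_of_le_add_lintegral κ T
  set α : ℝ≥0∞ := ‖x‖ₑ + a * (T * ‖lam0‖ₑ) with hα
  have hbound' : ∀ n, ∀ t ≤ T, ∫⁻ ω, S.normBefore lam n t ω ∂P ≤ α +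
      κ * ∫⁻ s in Set.Ioc (0 : ℝ) t, ∫⁻ ω, S.normBefore lam n s ω ∂P := fun n t ht => by
    refine (hbound n t).trans ?_
    rw [hα]
    gcongr
  have hint : ∀ n, ∫⁻ s in Set.Ioc (0 : ℝ) T, ∫⁻ ω, S.normBefore lam n s ω ∂P ≤ C * α :=
    fun n => by
    refine hC _ (h.measurable_normBefore n).lintegral_prod_right' _ (fun t ht => ?_) ?_
    · have := hbound' n t.toNNReal (Real.toNNReal_le_iff_le_coe.2 ht.2)
      rwa [Real.coe_toNNReal t ht.1.le] at this
    · rw [lintegral_lintegral_swap (h.measurable_normBefore n).aemeasurable]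
      exact h.lintegral_normBefore_ne_top hmean n T
  have hD : α + κ * (C * α) ≠ ∞ := by finiteness
  refine ⟨(α + κ * (C * α)).toNNReal, fun t ht => ?_⟩
  rw [ENNReal.coe_toNNReal hD]
  -- Each path has some `T n > t`, as only finitely many events precede `t`; the supremum is
  -- therefore attained.
  have hsup : ∀ ω, ‖lam t ω‖ₑ = ⨆ n, S.normBefore lam n t ω := fun ω => by
    refine le_antisymm ?_ (iSup_le fun n => ?_)
    · obtain ⟨n, hn⟩ := S.exists_lt_T t ω
      refine le_iSup_of_le n ?_
      rw [MarkedPointProcess.normBefore, Set.indicator_of_mem (by simpa using hn),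
        Real.toNNReal_coe]
    · refine (Set.indicator_le_self' (fun _ _ => zero_le) _).trans ?_
      rw [Real.toNNReal_coe]
  simp only [hsup]
  rw [lintegral_iSup (f := fun n ω => S.normBefore lam n t ω)
    (fun n => (h.measurable_normBefore n).comp measurable_prodMk_left)
    fun m n hmn ω => Set.indicator_le_indicator_of_subset
      (fun s hs => lt_of_lt_of_le hs (S.monotone_T ω hmn)) (fun _ => zero_le) _]
  refine iSup_le fun n => (hbound' n t ht).trans (add_le_add le_rfl (mul_le_mul_right ?_ _))
  refine le_trans (lintegral_mono_set (Set.Ioc_subset_Ioc_right ?_)) (hint n)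
  exact_mod_cast ht

/-! ### The equation for the mean and its solution -/

theorem integrable_lam [IsProbabilityMeasure P] [∀ k, IsProbabilityMeasure (ν k)]
    (hmean : ∀ k, Integrable (fun y : ℝ => y) (ν k))
    (h : IsSDEDrivenSelfExciting P 𝓕 (linearDrift A lam0) B
      (fun k => Kernel.const (Fin d → ℝ) (ν k)) x S lam) (t : ℝ≥0) :
    Integrable (lam t) P := by
  obtain ⟨D, hD⟩ := h.exists_lintegral_enorm_lam_le hmean t
  exact ⟨((h.adapted_lam t).mono (𝓕.le t) le_rfl).aestronglyMeasurable,
    (hD t le_rfl).trans_lt ENNReal.coe_lt_top⟩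

theorem integrable_uncurry_lam [IsProbabilityMeasure P] [∀ k, IsProbabilityMeasure (ν k)]
    (hmean : ∀ k, Integrable (fun y : ℝ => y) (ν k))
    (h : IsSDEDrivenSelfExciting P 𝓕 (linearDrift A lam0) B
      (fun k => Kernel.const (Fin d → ℝ) (ν k)) x S lam) (T : ℝ) :
    Integrable (fun p : ℝ × Ω => lam p.1.toNNReal p.2)
      ((volume.restrict (Set.Ioc (0 : ℝ) T)).prod P) := by
  obtain ⟨D, hD⟩ := h.exists_lintegral_enorm_lam_le hmean T.toNNReal
  refine ⟨h.measurable_uncurry_lam.aestronglyMeasurable, ?_⟩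
  rw [HasFiniteIntegral, lintegral_prod _ h.measurable_uncurry_lam.enorm.aemeasurable]
  calc _ ≤ ∫⁻ s in Set.Ioc (0 : ℝ) T, (D : ℝ≥0∞) :=
        setLIntegral_mono' measurableSet_Ioc fun s hs => hD _ (Real.toNNReal_le_toNNReal hs.2)
    _ < ∞ := by
      rw [setLIntegral_const]
      exact ENNReal.mul_lt_top ENNReal.coe_lt_top measure_Ioc_lt_top

theorem integrable_jumpSum_and_integral_eq [IsProbabilityMeasure P]
    [∀ k, IsProbabilityMeasure (ν k)] (hmean : ∀ k, Integrable (fun y : ℝ => y) (ν k))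
    (h : IsSDEDrivenSelfExciting P 𝓕 (linearDrift A lam0) B
      (fun k => Kernel.const (Fin d → ℝ) (ν k)) x S lam) (t : ℝ≥0) (k : Fin d) :
    Integrable (fun ω => S.jumpSum t ω k) P ∧
      ∫ ω, S.jumpSum t ω k ∂P =
        (∫ y, y ∂ν k) * ∫ s in Set.Ioc (0 : ℝ) t, ∫ ω, lam s.toNNReal ω k ∂P := by
  have hUm : Measurable fun ω => S.jumpSum t ω k :=
    (measurable_pi_apply k).comp ((h.adapted_jumpSum t).mono (𝓕.le t) le_rfl)
  have hint : Integrable (fun p : ℝ × Ω => lam p.1.toNNReal p.2 k)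
      ((volume.restrict (Set.Ioc (0 : ℝ) t)).prod P) :=
    (h.integrable_uncurry_lam hmean t).eval k
  have hL : ∫⁻ ω, (∫⁻ s in Set.Ioc (0 : ℝ) t, ENNReal.ofReal (lam s.toNNReal ω k)) ∂P =
      ENNReal.ofReal (∫ s in Set.Ioc (0 : ℝ) t, ∫ ω, lam s.toNNReal ω k ∂P) := by
    rw [← lintegral_lintegral_swap (f := fun (s : ℝ) ω => ENNReal.ofReal (lam s.toNNReal ω k))
        hint.1.aemeasurable.ennreal_ofReal,
      ofReal_integral_eq_lintegral_ofReal hint.integral_prod_left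
        (ae_of_all _ fun s => integral_nonneg fun ω => h.nonneg_lam _ ω k)]
    refine lintegral_congr fun s => ?_
    dsimp only
    rw [ofReal_integral_eq_lintegral_ofReal ((h.integrable_lam hmean _).eval k)
      (ae_of_all _ fun ω => h.nonneg_lam _ ω k)]
  have hU := h.lintegral_jumpSum k t
  have hL0 : 0 ≤ ∫ s in Set.Ioc (0 : ℝ) t, ∫ ω, lam s.toNNReal ω k ∂P :=
    integral_nonneg fun s => integral_nonneg fun ω => h.nonneg_lam _ ω k
  refine ⟨⟨hUm.aestronglyMeasurable, ?_⟩, ?_⟩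
  · rw [hasFiniteIntegral_iff_ofReal (ae_of_all _ fun ω => S.jumpSum_nonneg k t ω), hU, hL]
    exact ENNReal.mul_lt_top (hmean k).lintegral_lt_top ENNReal.ofReal_lt_top
  · rw [integral_eq_lintegral_of_nonneg_ae (ae_of_all _ fun ω => S.jumpSum_nonneg k t ω)
      hUm.aestronglyMeasurable, hU, hL, ENNReal.toReal_mul, ENNReal.toReal_ofReal hL0]
    -- `ν k` is not assumed to live on `[0, ∞)`, so `∫ y` and `∫⁻ ofReal y` may differ. They agree
    -- once some event of component `k` has positive probability; otherwise both sides vanish.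
    by_cases hzero : ∫ s in Set.Ioc (0 : ℝ) t, ∫ ω, lam s.toNNReal ω k ∂P = 0
    · rw [hzero, mul_zero, mul_zero]
    · obtain ⟨n, hn⟩ : ∃ n, P {ω | n ∈ S.events k t ω} ≠ 0 := by
        by_contra! hall
        have h1 := h.tsum_measure_event k t
        simp only [hall, tsum_zero, hL] at h1
        exact hzero (le_antisymm (ENNReal.ofReal_eq_zero.1 h1.symm) hL0)
      rw [integral_eq_lintegral_of_nonneg_ae (h.ae_nonneg_of_measure_event_ne_zero hn)
        measurable_id.aestronglyMeasurable]

theorem integral_lam_eq [IsProbabilityMeasure P] [∀ k, IsProbabilityMeasure (ν k)]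
    (hmean : ∀ k, Integrable (fun y : ℝ => y) (ν k))
    (h : IsSDEDrivenSelfExciting P 𝓕 (linearDrift A lam0) B
      (fun k => Kernel.const (Fin d → ℝ) (ν k)) x S lam) (t : ℝ≥0) :
    ∫ ω, lam t ω ∂P = x + (meanMatrix A B ν *ᵥ
      (∫ s in Set.Ioc (0 : ℝ) t, ∫ ω, lam s.toNNReal ω ∂P) - (t : ℝ) • (A *ᵥ lam0)) := by
  have hint := h.integrable_uncurry_lam hmean t
  set I : Ω → Fin d → ℝ := fun ω => ∫ s in Set.Ioc (0 : ℝ) t, lam s.toNNReal ω with hI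
  have hIint : Integrable I P := hint.integral_prod_right
  have hIeq : ∫ ω, I ω ∂P = ∫ s in Set.Ioc (0 : ℝ) t, ∫ ω, lam s.toNNReal ω ∂P :=
    (integral_integral_swap hint).symm
  have hUint : Integrable (S.jumpSum t) P :=
    Integrable.of_eval fun k => (h.integrable_jumpSum_and_integral_eq hmean t k).1
  have hUeq : ∫ ω, S.jumpSum t ω ∂P = Matrix.diagonal (fun k => ∫ y, y ∂ν k) *ᵥ
      ∫ s in Set.Ioc (0 : ℝ) t, ∫ ω, lam s.toNNReal ω ∂P := by
    ext k
    rw [Matrix.mulVec_diagonal, eval_integral fun k => hUint.eval k,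
      (h.integrable_jumpSum_and_integral_eq hmean t k).2,
      eval_integral fun k => hint.integral_prod_left.eval k]
    congr 1
    refine integral_congr_ae (ae_of_all _ fun s => ?_)
    exact (eval_integral (fun k => (h.integrable_lam hmean s.toNNReal).eval k) k).symm
  have hAint : Integrable (fun ω => A *ᵥ (I ω - (t : ℝ) • lam0)) P :=
    A.integrable_mulVec (hIint.sub (integrable_const _))
  have hAeq : ∫ ω, A *ᵥ (I ω - (t : ℝ) • lam0) ∂P = A *ᵥ (∫ ω, I ω ∂P - (t : ℝ) • lam0) := by
    rw [A.integral_mulVec (f := fun ω => I ω - (t : ℝ) • lam0)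
      (hIint.sub (integrable_const ((t : ℝ) • lam0))), integral_sub hIint (integrable_const _)]
    simp
  have hBint : Integrable (fun ω => B *ᵥ S.jumpSum t ω) P :=
    B.integrable_mulVec hUint
  have hBeq : ∫ ω, B *ᵥ S.jumpSum t ω ∂P = B *ᵥ ∫ ω, S.jumpSum t ω ∂P := by
    exact B.integral_mulVec hUint
  rw [integral_congr_ae (h.lam_eq.mono fun ω hω => hω t),
    integral_add (f := fun ω => x + A *ᵥ (I ω - (t : ℝ) • lam0))
      ((integrable_const x).add hAint) hBint,
    integral_add (integrable_const x) hAint, hAeq, hBeq, hUeq, hIeq, integral_const]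
  simp only [probReal_univ, one_smul, meanMatrix, Matrix.add_mulVec, Matrix.mulVec_sub,
    Matrix.mulVec_smul, Matrix.mulVec_mulVec]
  abel

/-- The mean of the intensity of the linear model. -/
theorem integral_lam [IsProbabilityMeasure P] [∀ k, IsProbabilityMeasure (ν k)]
    (hmean : ∀ k, Integrable (fun y : ℝ => y) (ν k))
    (h : IsSDEDrivenSelfExciting P 𝓕 (linearDrift A lam0) B
      (fun k => Kernel.const (Fin d → ℝ) (ν k)) x S lam)
    (hM : IsUnit (meanMatrix A B ν)) (t : ℝ≥0) :
    ∫ ω, lam t ω ∂P =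
      ((meanMatrix A B ν)⁻¹ * A) *ᵥ lam0 +
        NormedSpace.exp ((t : ℝ) • meanMatrix A B ν) *ᵥ
          (x - ((meanMatrix A B ν)⁻¹ * A) *ᵥ lam0) := by
  set M := meanMatrix A B ν
  -- `c` solves `M c = A lam0`; subtracting it removes the constant drift.
  set c : Fin d → ℝ := (M⁻¹ * A) *ᵥ lam0 with hc
  have hMc : M *ᵥ c = A *ᵥ lam0 := by
    rw [hc, Matrix.mulVec_mulVec, ← Matrix.mul_assoc,
      Matrix.mul_nonsing_inv _ ((Matrix.isUnit_iff_isUnit_det _).1 hM), one_mul]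
  have hyint : ∀ T : ℝ, IntegrableOn (fun s : ℝ => ∫ ω, lam s.toNNReal ω ∂P) (Set.Ioc 0 T) :=
    fun T => (h.integrable_uncurry_lam hmean T).integral_prod_left
  have hym : Measurable fun s : ℝ => ∫ ω, lam s.toNNReal ω ∂P :=
    h.measurable_uncurry_lam.stronglyMeasurable.integral_prod_right'.measurable
  have hzint : ∀ T : ℝ, IntegrableOn (fun s : ℝ => ∫ ω, lam s.toNNReal ω ∂P - c) (Set.Ioc 0 T) :=
    fun T => (hyint T).sub (integrable_const c)
  have key := eq_exp_smul_mulVec_of_integral_eq M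
    (z := fun s => ∫ ω, lam s.toNNReal ω ∂P - c) (z₀ := x - c) (hym.sub_const c) hzint
    (fun s hs => ?_) t.coe_nonneg
  · simp only [Real.toNNReal_coe] at key
    rw [← key]
    abel
  · have h1 := M.integral_mulVec (hzint s)
    rw [integral_sub (hyint s) (integrable_const c)] at h1
    have h2 := h.integral_lam_eq hmean s.toNNReal
    rw [Real.coe_toNNReal s hs] at h2
    rw [intervalIntegral.integral_of_le hs, h1, h2]
    simp only [Matrix.mulVec_sub, integral_const, Matrix.mulVec_smul, hMc]
    simp only [measureReal_restrict_apply_univ, Real.volume_real_Ioc, sub_zero, max_eq_left hs]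
    abel

end IsSDEDrivenSelfExciting

theorem mainTheorem5 {Ω : Type*} [mΩ : MeasurableSpace Ω] (P : Measure Ω) [IsProbabilityMeasure P]
    (𝓕 : Filtration ℝ≥0 mΩ) {d : ℕ} (A B : Matrix (Fin d) (Fin d) ℝ)
    (ν : Fin d → Measure ℝ) (hν : ∀ k, IsProbabilityMeasure (ν k))
    (hmean : ∀ k, Integrable (fun x : ℝ => x) (ν k))
    (lam0 x : Fin d → ℝ) (hlam0 : 0 ≤ lam0) (hx : lam0 ≤ x)
    (S : MarkedPointProcess Ω d) (lam : ℝ≥0 → Ω → (Fin d → ℝ))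
    (h : IsSDEDrivenSelfExciting P 𝓕 (linearDrift A lam0) B
      (fun k => Kernel.const (Fin d → ℝ) (ν k)) x S lam) :
    (∀ t : ℝ≥0, Integrable (lam t) P) ∧
    (IsUnit (meanMatrix A B ν) → ∀ t : ℝ≥0,
      ∫ ω, lam t ω ∂P =
        ((meanMatrix A B ν)⁻¹ * A) *ᵥ lam0 +
          NormedSpace.exp ((t : ℝ) • meanMatrix A B ν) *ᵥ
            (x - ((meanMatrix A B ν)⁻¹ * A) *ᵥ lam0)) ∧
    ((∀ γ : ℝ, Module.End.HasEigenvalue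
        (Matrix.toLin' (meanMatrix A B ν + (meanMatrix A B ν)ᵀ)) γ → γ < 0) →
      IsUnit (meanMatrix A B ν) ∧
      Tendsto (fun t : ℝ≥0 => ∫ ω, lam t ω ∂P) atTop
        (𝓝 (((meanMatrix A B ν)⁻¹ * A) *ᵥ lam0))) := by
  refine ⟨h.integrable_lam hmean, h.integral_lam hmean, fun hγ => ?_⟩
  obtain ⟨c, hc, hle⟩ := Matrix.exists_pos_dotProduct_mulVec_le hγ
  have hM := Matrix.isUnit_of_dotProduct_mulVec_le hc hle
  refine ⟨hM, ?_⟩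
  simp only [h.integral_lam hmean hM]
  have h1 := (Matrix.tendsto_exp_smul_mulVec_zero hc hle
    (x - ((meanMatrix A B ν)⁻¹ * A) *ᵥ lam0)).comp
    (NNReal.tendsto_coe_atTop.2 tendsto_id)
  simpa [Function.comp_def] using h1.const_add (((meanMatrix A B ν)⁻¹ * A) *ᵥ lam0)
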